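/- Let $0<\alpha_0<\beta_0<1$ and $\gamma>0$ be fixed. For $N=2^M$, $M=0,1,2,\dots$, let $S^0_N=[\lfloor\alpha_0N\rfloor,\lfloor\beta_0N\rfloor)$ and let $X_0,\dots,X_{N-1}$ (depending on $N$) be independent exponential random variables with $\mathbb E[X_n]=1+\gamma$ if $n\in S^0_N$ and $\mathbb E[X_n]=1$ otherwise; all these variables, for all $N$, are defined on one probability space, with an arbitrary joint law for different $N$. For an interval $S=[a,b)\subseteq[0,N)$ of integers with $a<b$, let $\overline X_S=\frac1{|S|}\sum_{n\in S}X_n$, $\overline X_S^+=\max\{\overline X_S,1\}$ and $J(S)=|S|\,[\overline X_S^+-1-\log \overline X_S^+]$. The binary interval estimation algorithm computes intervals $\widehat S^{(t)}_N=[\widehat a^{(t)}_N,\widehat b^{(t)}_N)$, $t=0,\dots,M$, as follows. Start with $\widehat S^{(0)}_N=[0,N)$. Given $[\widehat a,\widehat b)=\widehat S^{(t)}_N$ with $t<M$, put $\ell=2^{M-t-1}$. First update the left boundary: among the admissible candidates $\widehat a,\ \widehat a-\ell,\ \widehat a+\ell$ (a candidate $a'$ is admissible if $0\le a'<\widehat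 b$), taken in this order, let $\widehat a^{(t+1)}_N$ be the first one that maximizes $J([a',\widehat b))$. Then update the right boundary: among the admissible candidates $\widehat b,\ \widehat b-\ell,\ \widehat b+\ell$ (a candidate $b'$ is admissible if $\widehat a^{(t+1)}_N<b'\le N$), taken in this order, let $\widehat b^{(t+1)}_N$ be the first one that maximizes $J([\widehat a^{(t+1)}_N,b'))$. (The averages $\overline X_S$ are not recomputed but updated from the precomputed averages of $X$ over the dyadic intervals $[i2^m,(i+1)2^m)$.) After the $M$ iterations the estimate no longer changes: $\widehat S^{(t)}_N=\widehat S^{(M)}_N$ for $t>M$. Then the intersection over union $$\mathrm{IoU}^{(t)}_N=\frac{|\widehat S^{(t)}_N\cap S^0_N|}{|\widehat S^{(t)}_N\cup S^0_N|}$$ satisfies, almost surely, $\lim_{N,t\to\infty}\mathrm{IoU}^{(t)}_N=1$, as a joint limit in which $N\to\infty$ through the powers of two and $t\to\infty$. -/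

import Mathlib

/-! ### The statistical model -/

/-- The true signal interval `[⌊α₀ N⌋, ⌊β₀ N⌋)` among the bins `0, …, N - 1`, with `N = 2 ^ M`. -/
noncomputable def trueInterval (α₀ β₀ : ℝ) (M : ℕ) : Finset ℤ :=
  Finset.Ico ⌊α₀ * (2 : ℝ) ^ M⌋ ⌊β₀ * (2 : ℝ) ^ M⌋

/-- The expected power of bin `n`: `1 + γ` in the signal interval `S`, and `1` outside. -/
noncomputable def meanPower (γ : ℝ) (S : Finset ℤ) (n : ℕ) : ℝ :=
  if (n : ℤ) ∈ S then 1 + γ else 1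

/-! ### The binary interval estimation algorithm -/

/-- The dyadic powers `Z_{m,i}`, i.e. the averages of `X` over `[i 2 ^ m, (i + 1) 2 ^ m)`,
computed by repeatedly merging adjacent intervals. -/
noncomputable def dyadicPower (X : ℕ → ℝ) : ℕ → ℕ → ℝ
  | 0, i => X i
  | m + 1, i => (dyadicPower X m (2 * i) + dyadicPower X m (2 * i + 1)) / 2

/-- The likelihood of an interval of length `L` and average power `Z`,
maximized over the SNR: `L (Z⁺ - 1 - log Z⁺)` with `Z⁺ = max {Z, 1}`. -/
noncomputable def objective (L Z : ℝ) : ℝ :=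
  L * (max Z 1 - 1 - Real.log (max Z 1))

/-- The variables of the search: the left and right indices of the current interval (in units of
the current sub-interval length), its average power, its length, and the best objective so far. -/
structure SearchState where
  left : ℤ
  right : ℤ
  avg : ℝ
  len : ℝ
  best : ℝ

/-- The initial state: the whole interval `[0, 2 ^ M)`, as one sub-interval of length `2 ^ M`. -/
noncomputable def initState (X : ℕ → ℝ) (M : ℕ) : SearchState where
  left := 0
  right := 1
  avg := dyadicPower X M 0
  len := (2 : ℝ) ^ M
  best := objective ((2 : ℝ) ^ M) (dyadicPower X M 0)

/-- Try to move the left boundary of `base` by `δ = ± 1` sub-intervals of length `2 ^ m`; the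
incumbent `cur` is replaced if the objective increases strictly and the new interval is admissible.
The sub-interval that is added or removed is the one with index `min {left, left + δ}`. -/
noncomputable def tryLeft (X : ℕ → ℝ) (m : ℕ) (base cur : SearchState) (δ : ℤ) : SearchState :=
  let i' : ℤ := base.left + δ
  let L' : ℝ := base.len - δ * (2 : ℝ) ^ m
  let Z' : ℝ := (base.len * base.avg
    - δ * (2 : ℝ) ^ m * dyadicPower X m (min base.left i').toNat) / L'
  let J' : ℝ := objective L' Z'
  open Classical in
  if cur.best < J' ∧ 0 < L' ∧ 0 ≤ i' then
    { cur with left := i', avg := Z', len := L', best := J' }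
  else cur

/-- Try to move the right boundary of `base` by `δ = ± 1` sub-intervals of length `2 ^ m`, where
`bound` is the number of sub-intervals of `[0, N)`.
The sub-interval that is added or removed is the one with index `min {right, right + δ}`. -/
noncomputable def tryRight (X : ℕ → ℝ) (m : ℕ) (bound : ℤ) (base cur : SearchState) (δ : ℤ) :
    SearchState :=
  let j' : ℤ := base.right + δ
  let L' : ℝ := base.len + δ * (2 : ℝ) ^ m
  let Z' : ℝ := (base.len * base.avg
    + δ * (2 : ℝ) ^ m * dyadicPower X m (min base.right j').toNat) / L'
  let J' : ℝ := objective L' Z'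
  open Classical in
  if cur.best < J' ∧ 0 < L' ∧ j' ≤ bound then
    { cur with right := j', avg := Z', len := L', best := J' }
  else cur

/-- Iteration `t` of the search (`0 ≤ t < M`): the sub-interval length is halved to
`2 ^ (M - t - 1)`, so that the indices of the boundaries double; then the left boundary is optimized
over `δ = -1, 1` (in this order), and after it the right boundary. -/
noncomputable def searchStep (X : ℕ → ℝ) (M t : ℕ) (s : SearchState) : SearchState :=
  let m : ℕ := M - t - 1
  let s₀ : SearchState := { s with left := 2 * s.left, right := 2 * s.right }
  let s₁ : SearchState := tryLeft X m s₀ (tryLeft X m s₀ s₀ (-1)) 1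
  tryRight X m (2 ^ (t + 1)) s₁ (tryRight X m (2 ^ (t + 1)) s₁ s₁ (-1)) 1

/-- The state of the search on `X 0, …, X (2 ^ M - 1)` after `t` iterations. -/
noncomputable def searchState (X : ℕ → ℝ) (M : ℕ) : ℕ → SearchState
  | 0 => initState X M
  | t + 1 => searchStep X M t (searchState X M t)

/-- The `t`-th estimate `[i ℓ, j ℓ)`, with sub-interval length `ℓ = 2 ^ (M - t)`, for `t ≤ M`.
The search stops after `M` iterations; for `t > M` the estimate is the final one. -/
noncomputable def estimatedInterval (X : ℕ → ℝ) (M t : ℕ) : Finset ℤ :=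
  let s := searchState X M (min t M)
  let ℓ : ℤ := 2 ^ (M - min t M)
  Finset.Ico (s.left * ℓ) (s.right * ℓ)

/-- Intersection over union. -/
noncomputable def IoU (S T : Finset ℤ) : ℝ :=
  ((S ∩ T).card : ℝ) / ((S ∪ T).card : ℝ)

/-!
The objective `J` is convex in the average power. Comparing it with its tangent line shows that `J`
strictly increases when one cuts off a piece of average about `1`, or adjoins a piece of average
about `1 + γ`, as soon as the errors in the interval sums are small compared with the number of
bins in the piece. Since `J` of the whole interval is of order `N` and the search never decreases
`J`, the first `T` greedy steps therefore keep each boundary within one sub-interval of the true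
one, and the later steps move it by at most `2 ^ (-T) * N` in all. Thus `1 - IoU` is of order
`2 ^ (-T)` once `N` is so large that the errors are small compared with `2 ^ (-T) * N`.

All interval sums are controlled at once by a uniform law of large numbers: Chebyshev's inequality
and the Borel–Cantelli lemma, applicable because `∑ 1 / N` converges along `N = 2 ^ M`, give it on a
grid of finitely many points, and also for the sums of the absolute deviations over the grid cells,
which control the gaps.
-/

/-! ### The objective -/

theorem objective_of_one_le {L Z : ℝ} (hZ : 1 ≤ Z) : objective L Z = L * (Z - 1 - Real.log Z) := by
  rw [objective, max_eq_left hZ]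

theorem one_lt_of_objective_pos {L Z : ℝ} (h : 0 < objective L Z) : 1 < Z := by
  by_contra! hZ
  simp [objective, max_eq_right hZ] at h

-- The left-hand side is the tangent line at `z` of the convex function `z ↦ z - 1 - log z`.
theorem mul_sub_mul_log_le_objective {L z : ℝ} (s : ℝ) (hL : 0 < L) (hz : 1 ≤ z) :
    s * (1 - z⁻¹) - L * Real.log z ≤ objective L (s / L) := by
  rw [objective]
  set w := max (s / L) 1
  have hz₀ : 0 < z := by linarith
  have hw : 0 < w := zero_lt_one.trans_le (le_max_right _ _)
  have hsw : s ≤ L * w := by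
    rw [mul_comm, ← div_le_iff₀ hL]
    exact le_max_left _ _
  have hlog : Real.log w - Real.log z ≤ w * z⁻¹ - 1 := by
    rw [← Real.log_div hw.ne' hz₀.ne', ← div_eq_mul_inv]
    exact Real.log_le_sub_one_of_pos (by positivity)
  calc s * (1 - z⁻¹) - L * Real.log z
      ≤ L * w * (1 - z⁻¹) - L * Real.log z := by
        gcongr
        exact sub_nonneg.2 (inv_le_one_of_one_le₀ hz)
    _ = L * (w - 1 - (w * z⁻¹ - 1 + Real.log z)) := by ring
    _ ≤ L * (w - 1 - Real.log w) := by gcongr; linarith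

theorem le_objective_div {L s z : ℝ} (hL : 0 < L) (hz : 1 ≤ z) (hs : L * z ≤ s) :
    L * (z - 1 - Real.log z) ≤ objective L (s / L) := by
  have hinv : z * z⁻¹ = 1 := mul_inv_cancel₀ (by linarith)
  calc L * (z - 1 - Real.log z) = L * z * (1 - z⁻¹) - L * Real.log z := by
        linear_combination L * hinv
    _ ≤ s * (1 - z⁻¹) - L * Real.log z := by
        gcongr
        exact sub_nonneg.2 (inv_le_one_of_one_le₀ hz)
    _ ≤ objective L (s / L) := mul_sub_mul_log_le_objective s hL hz

theorem objective_div_le_of_le_add {L s e : ℝ} (hL : 0 < L) (he : 0 ≤ e) (hs : s ≤ L + e) :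
    objective L (s / L) ≤ e := by
  rcases le_or_gt (objective L (s / L)) 0 with h | h
  · exact h.trans he
  · have hz := (one_lt_of_objective_pos h).le
    calc objective L (s / L) = L * (s / L) - L - L * Real.log (s / L) := by
          rw [objective_of_one_le hz]; ring
      _ = s - L - L * Real.log (s / L) := by rw [mul_div_cancel₀ s hL.ne']
      _ ≤ e := by linarith [mul_nonneg hL.le (Real.log_nonneg hz)]

theorem sub_one_sub_log_le_mul {z : ℝ} (hz : 1 ≤ z) :
    z - 1 - Real.log z ≤ z * (Real.log z - 1 + z⁻¹) := by
  have hlog : 2 * (z - 1) / (z - 1 + 2) ≤ Real.log z := by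
    simpa using Real.le_log_one_add_of_nonneg (sub_nonneg.2 hz)
  rw [div_le_iff₀ (by linarith)] at hlog
  have hinv : z * z⁻¹ = 1 := mul_inv_cancel₀ (by linarith)
  linarith

theorem objective_lt_of_remove {L l s d e : ℝ} (hl : 0 < l) (hlL : l < L) (he : 0 ≤ e)
    (hd : d ≤ l + e) (hpos : 0 < objective L (s / L)) (hlt : e * s < l * objective L (s / L)) :
    objective L (s / L) < objective (L - l) ((s - d) / (L - l)) := by
  have hz : 1 < s / L := one_lt_of_objective_pos hpos
  have htan := mul_sub_mul_log_le_objective (s - d) (sub_pos.2 hlL) hz.le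
  have hs : s = L * (s / L) := (mul_div_cancel₀ s (hl.trans hlL).ne').symm
  set z := s / L
  have hz₀ : 0 < z := by linarith
  have hinv : z * z⁻¹ = 1 := mul_inv_cancel₀ hz₀.ne'
  rw [objective_of_one_le hz.le] at hlt ⊢
  have hgain : e < l * (Real.log z - 1 + z⁻¹) := by
    have h : L * z * e < L * z * (l * (Real.log z - 1 + z⁻¹)) := by
      calc L * z * e < l * (L * (z - 1 - Real.log z)) := by rwa [← hs, mul_comm]
        _ ≤ l * (L * (z * (Real.log z - 1 + z⁻¹))) := by
          have := sub_one_sub_log_le_mul hz.le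
          have := hl.trans hlL
          gcongr
        _ = L * z * (l * (Real.log z - 1 + z⁻¹)) := by ring
    exact lt_of_mul_lt_mul_left h (mul_nonneg (hl.trans hlL).le hz₀.le)
  have hloss : d * (1 - z⁻¹) ≤ l * (1 - z⁻¹) + e := by
    have h₁ : 0 ≤ 1 - z⁻¹ := sub_nonneg.2 (inv_le_one_of_one_le₀ hz.le)
    have h₂ : 0 ≤ e * z⁻¹ := by positivity
    linarith [mul_le_mul_of_nonneg_right hd h₁]
  have htotal : s * (1 - z⁻¹) = L * (z - 1) := by rw [hs]; linear_combination -L * hinv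
  linarith

theorem objective_lt_of_add {L l s d e p : ℝ} (hL : 0 < L) (hl : 0 < l) (he : 0 ≤ e)
    (hs : s ≤ p * L + e) (hd : p * l - e ≤ d) (hpos : 0 < objective L (s / L))
    (hlt : e * (L + l) < l * objective L (s / L)) :
    objective L (s / L) < objective (L + l) ((s + d) / (L + l)) := by
  have hz : 1 < s / L := one_lt_of_objective_pos hpos
  have htan := mul_sub_mul_log_le_objective (s + d) (add_pos hL hl) hz.le
  have hsz : s = L * (s / L) := (mul_div_cancel₀ s hL.ne').symm
  set z := s / L
  have hinv : z * z⁻¹ = 1 := mul_inv_cancel₀ (by linarith)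
  have hnonneg : 0 ≤ 1 - z⁻¹ := sub_nonneg.2 (inv_le_one_of_one_le₀ hz.le)
  rw [objective_of_one_le hz.le] at hlt ⊢
  have htotal : s * (1 - z⁻¹) = L * (z - 1) := by rw [hsz]; linear_combination -L * hinv
  have hgain : 0 < L * (d * (1 - z⁻¹) - l * Real.log z) := by
    have h₁ : l * s - e * (L + l) ≤ L * d := by
      linarith [mul_le_mul_of_nonneg_left hs hl.le, mul_le_mul_of_nonneg_left hd hL.le]
    have h₂ : e * (L + l) * (1 - z⁻¹) ≤ e * (L + l) :=
      mul_le_of_le_one_right (by positivity) (by linarith [inv_pos.2 (zero_lt_one.trans hz)])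
    calc 0 < l * (L * (z - 1 - Real.log z)) - e * (L + l) := sub_pos.2 hlt
      _ ≤ l * (L * (z - 1 - Real.log z)) - e * (L + l) * (1 - z⁻¹) := by gcongr
      _ = (l * s - e * (L + l)) * (1 - z⁻¹) - L * (l * Real.log z) := by
        linear_combination -l * htotal
      _ ≤ L * d * (1 - z⁻¹) - L * (l * Real.log z) := by gcongr
      _ = L * (d * (1 - z⁻¹) - l * Real.log z) := by ring
  linarith [pos_of_mul_pos_right hgain hL.le]

/-! ### Interval sums -/

/-- The sum of `x` over the bins in `[a, b)`, with the opposite sign if `b < a`, so that it is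
additive in the interval without order assumptions. -/
noncomputable def intervalSum (x : ℕ → ℝ) (a b : ℤ) : ℝ :=
  ∑ n ∈ Finset.range b.toNat, x n - ∑ n ∈ Finset.range a.toNat, x n

/-- The value of the objective at the interval `[a, b)`, for `a < b`. -/
noncomputable def intervalObjective (x : ℕ → ℝ) (a b : ℤ) : ℝ :=
  objective ((b : ℝ) - a) (intervalSum x a b / ((b : ℝ) - a))

theorem intervalSum_add_adjacent (x : ℕ → ℝ) (a b c : ℤ) :
    intervalSum x a b + intervalSum x b c = intervalSum x a c :=
  sub_add_sub_cancel' _ _ _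

theorem intervalSum_symm (x : ℕ → ℝ) (a b : ℤ) : intervalSum x b a = -intervalSum x a b :=
  (neg_sub _ _).symm

theorem intervalSum_natCast (x : ℕ → ℝ) {k l : ℕ} (h : k ≤ l) :
    intervalSum x k l = ∑ n ∈ Finset.Ico k l, x n :=
  (Finset.sum_Ico_eq_sub x h).symm

theorem intervalSum_mono {x y : ℕ → ℝ} {a b : ℤ} (ha : 0 ≤ a) (hab : a ≤ b)
    (h : ∀ n : ℕ, a ≤ n → n < b → x n ≤ y n) : intervalSum x a b ≤ intervalSum y a b := by
  lift a to ℕ using ha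
  lift b to ℕ using by lia
  rw [intervalSum_natCast x (mod_cast hab), intervalSum_natCast y (mod_cast hab)]
  refine Finset.sum_le_sum fun n hn => ?_
  rw [Finset.mem_Ico] at hn
  exact h n (mod_cast hn.1) (mod_cast hn.2)

theorem intervalSum_congr {x y : ℕ → ℝ} {a b : ℤ} (ha : 0 ≤ a) (hab : a ≤ b)
    (h : ∀ n : ℕ, a ≤ n → n < b → x n = y n) : intervalSum x a b = intervalSum y a b :=
  (intervalSum_mono ha hab fun n h₁ h₂ => (h n h₁ h₂).le).antisymm
    (intervalSum_mono ha hab fun n h₁ h₂ => (h n h₁ h₂).ge)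

theorem intervalSum_const (c : ℝ) {a b : ℤ} (ha : 0 ≤ a) (hab : a ≤ b) :
    intervalSum (fun _ => c) a b = c * ((b : ℝ) - a) := by
  lift a to ℕ using ha
  lift b to ℕ using by lia
  simp only [intervalSum, Finset.sum_const, Finset.card_range, nsmul_eq_mul, Int.toNat_natCast,
    Int.cast_natCast]
  ring

theorem two_pow_mul_dyadicPower (x : ℕ → ℝ) (m i : ℕ) :
    2 ^ m * dyadicPower x m i = intervalSum x (i * 2 ^ m) ((i + 1) * 2 ^ m) := by
  induction m generalizing i with
  | zero => simp [dyadicPower, intervalSum, Finset.sum_range_succ]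
  | succ m ih =>
    calc (2 : ℝ) ^ (m + 1) * dyadicPower x (m + 1) i
        = 2 ^ m * dyadicPower x m (2 * i) + 2 ^ m * dyadicPower x m (2 * i + 1) := by
          rw [dyadicPower]; ring
      _ = intervalSum x ((2 * i : ℕ) * 2 ^ m) (((2 * i : ℕ) + 1) * 2 ^ m) +
          intervalSum x ((2 * i + 1 : ℕ) * 2 ^ m) (((2 * i + 1 : ℕ) + 1) * 2 ^ m) := by rw [ih, ih]
      _ = intervalSum x (i * 2 ^ (m + 1)) ((i + 1) * 2 ^ (m + 1)) := by
          push_cast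
          rw [intervalSum_add_adjacent]
          congr 1 <;> ring

theorem mul_dyadicPower_min (x : ℕ → ℝ) (m : ℕ) {i δ : ℤ} (hδ : δ = -1 ∨ δ = 1) (hi : 0 ≤ i)
    (hiδ : 0 ≤ i + δ) :
    δ * 2 ^ m * dyadicPower x m (min i (i + δ)).toNat =
      intervalSum x (i * 2 ^ m) ((i + δ) * 2 ^ m) := by
  rcases hδ with rfl | rfl
  · lift i + -1 to ℕ using hiδ with k hk
    obtain rfl : i = k + 1 := by lia
    rw [intervalSum_symm, ← two_pow_mul_dyadicPower]
    simp
  · lift i to ℕ using hi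
    rw [← two_pow_mul_dyadicPower]
    simp

/-! ### The search as a greedy maximization -/

/-- The state `s`, with indices in units of `2 ^ m`, describes the nonempty interval `[a, b)`. -/
structure SearchState.Describes (x : ℕ → ℝ) (m : ℕ) (s : SearchState) (a b : ℤ) : Prop where
  left_mul : s.left * 2 ^ m = a
  right_mul : s.right * 2 ^ m = b
  nonneg : 0 ≤ a
  lt : a < b
  len_eq : s.len = b - a
  len_mul_avg : s.len * s.avg = intervalSum x a b
  best_eq : s.best = intervalObjective x a b

/-- The admissible candidates for the left boundary of `[a, b)` at scale `l`. -/
def leftCandidates (l a b : ℤ) : Set ℤ :=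
  {c | c ∈ ({a, a - l, a + l} : Set ℤ) ∧ 0 ≤ c ∧ c < b}

/-- The admissible candidates for the right boundary of `[a, b) ⊆ [0, N)` at scale `l`. -/
def rightCandidates (N l a b : ℤ) : Set ℤ :=
  {c | c ∈ ({b, b - l, b + l} : Set ℤ) ∧ a < c ∧ c ≤ N}

/-- An iteration at scale `l` may lead from `[a, b)` to `[a', b')`: first the left and then the
right boundary maximizes the objective `J` among its admissible candidates. How ties are broken is
irrelevant for consistency and left open. -/
structure IsGreedyStep (J : ℤ → ℤ → ℝ) (N l a b a' b' : ℤ) : Prop where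
  left_mem : a' ∈ leftCandidates l a b
  isMaxOn_left : IsMaxOn (fun c => J c b) (leftCandidates l a b) a'
  right_mem : b' ∈ rightCandidates N l a' b
  isMaxOn_right : IsMaxOn (J a') (rightCandidates N l a' b) b'

section Search

variable {x : ℕ → ℝ} {m : ℕ} {s cur : SearchState} {a b c δ bound : ℤ}

theorem SearchState.Describes.halve (hs : s.Describes x (m + 1) a b) :
    SearchState.Describes x m { s with left := 2 * s.left, right := 2 * s.right } a b :=
  { hs with
    left_mul := by rw [← hs.left_mul]; ring
    right_mul := by rw [← hs.right_mul]; ring }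

theorem SearchState.Describes.exists_tryLeft (hs : s.Describes x m a b)
    (hcur : cur.Describes x m c b) (hδ : δ = -1 ∨ δ = 1) :
    ∃ c', (tryLeft x m s cur δ).Describes x m c' b ∧ (c' = c ∨ c' = a + δ * 2 ^ m) ∧
      intervalObjective x c b ≤ intervalObjective x c' b ∧
      (0 ≤ a + δ * 2 ^ m → a + δ * 2 ^ m < b →
        intervalObjective x (a + δ * 2 ^ m) b ≤ intervalObjective x c' b) := by
  have hleft : (s.left + δ) * 2 ^ m = a + δ * 2 ^ m := by rw [add_mul, hs.left_mul]
  have hnonneg : 0 ≤ s.left + δ ↔ 0 ≤ a + δ * 2 ^ m := by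
    rw [← hleft, mul_nonneg_iff_of_pos_right (by positivity)]
  have hlen : s.len - δ * 2 ^ m = (b : ℝ) - (a + δ * 2 ^ m : ℤ) := by
    rw [hs.len_eq]; push_cast; ring
  have hpos : 0 < s.len - δ * 2 ^ m ↔ a + δ * 2 ^ m < b := by
    rw [hlen, sub_pos, Int.cast_lt]
  have hsum (h₀ : 0 ≤ s.left + δ) :
      s.len * s.avg - δ * 2 ^ m * dyadicPower x m (min s.left (s.left + δ)).toNat =
        intervalSum x (a + δ * 2 ^ m) b := by
    have hi : 0 ≤ s.left := nonneg_of_mul_nonneg_left (hs.left_mul.symm ▸ hs.nonneg) (by positivity)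
    rw [mul_dyadicPower_min x m hδ hi h₀, hs.len_mul_avg, hleft, hs.left_mul,
      ← intervalSum_add_adjacent x a (a + δ * 2 ^ m) b, add_sub_cancel_left]
  rw [tryLeft]
  split_ifs with h
  · obtain ⟨hlt, hL, h₀⟩ := h
    have hJ := hlt
    rw [hsum h₀, hlen, hcur.best_eq] at hJ
    refine ⟨a + δ * 2 ^ m, ?_, .inr rfl, hJ.le, fun _ _ => le_rfl⟩
    exact
      { left_mul := hleft
        right_mul := hcur.right_mul
        nonneg := hnonneg.1 h₀
        lt := hpos.1 hL
        len_eq := hlen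
        len_mul_avg := by rw [hsum h₀, mul_div_cancel₀ _ hL.ne']
        best_eq := by rw [hsum h₀, hlen, intervalObjective] }
  · refine ⟨c, hcur, .inl rfl, le_rfl, fun h₀ hlt => ?_⟩
    rw [hsum (hnonneg.2 h₀), hpos, hnonneg, hlen, hcur.best_eq] at h
    exact not_lt.1 fun hJ => h ⟨hJ, hlt, h₀⟩

theorem SearchState.Describes.exists_tryRight (hs : s.Describes x m a b)
    (hcur : cur.Describes x m a c) (hδ : δ = -1 ∨ δ = 1) :
    ∃ c', (tryRight x m bound s cur δ).Describes x m a c' ∧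
      (c' = c ∨ c' = b + δ * 2 ^ m ∧ b + δ * 2 ^ m ≤ bound * 2 ^ m) ∧
      intervalObjective x a c ≤ intervalObjective x a c' ∧
      (a < b + δ * 2 ^ m → b + δ * 2 ^ m ≤ bound * 2 ^ m →
        intervalObjective x a (b + δ * 2 ^ m) ≤ intervalObjective x a c') := by
  have hright : (s.right + δ) * 2 ^ m = b + δ * 2 ^ m := by rw [add_mul, hs.right_mul]
  have hle : s.right + δ ≤ bound ↔ b + δ * 2 ^ m ≤ bound * 2 ^ m := by
    rw [← hright, mul_le_mul_iff_of_pos_right (by positivity)]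
  have hlen : s.len + δ * 2 ^ m = ((b + δ * 2 ^ m : ℤ) : ℝ) - a := by
    rw [hs.len_eq]; push_cast; ring
  have hpos : 0 < s.len + δ * 2 ^ m ↔ a < b + δ * 2 ^ m := by
    rw [hlen, sub_pos, Int.cast_lt]
  have hsum (hlt : a < b + δ * 2 ^ m) :
      s.len * s.avg + δ * 2 ^ m * dyadicPower x m (min s.right (s.right + δ)).toNat =
        intervalSum x a (b + δ * 2 ^ m) := by
    have hi {i : ℤ} (h : a < i * 2 ^ m) : 0 ≤ i :=
      nonneg_of_mul_nonneg_left (hs.nonneg.trans h.le) (by positivity)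
    rw [mul_dyadicPower_min x m hδ (hi (hs.right_mul.symm ▸ hs.lt)) (hi (hright.symm ▸ hlt)),
      hs.len_mul_avg, hright, hs.right_mul, intervalSum_add_adjacent]
  rw [tryRight]
  split_ifs with h
  · obtain ⟨hlt, hL, hN⟩ := h
    have hab := hpos.1 hL
    have hJ := hlt
    rw [hsum hab, hlen, hcur.best_eq] at hJ
    refine ⟨b + δ * 2 ^ m, ?_, .inr ⟨rfl, hle.1 hN⟩, hJ.le, fun _ _ => le_rfl⟩
    exact
      { left_mul := hcur.left_mul
        right_mul := hright
        nonneg := hs.nonneg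
        lt := hab
        len_eq := hlen
        len_mul_avg := by rw [hsum hab, mul_div_cancel₀ _ hL.ne']
        best_eq := by rw [hsum hab, hlen, intervalObjective] }
  · refine ⟨c, hcur, .inl rfl, le_rfl, fun hab hN => ?_⟩
    rw [hsum hab, hpos, hle, hlen, hcur.best_eq] at h
    exact not_lt.1 fun hJ => h ⟨hJ, hab, hN⟩

theorem SearchState.Describes.exists_isMaxOn_left (hs : s.Describes x m a b) :
    ∃ a', (tryLeft x m s (tryLeft x m s s (-1)) 1).Describes x m a' b ∧
      a' ∈ leftCandidates (2 ^ m) a b ∧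
      IsMaxOn (fun c => intervalObjective x c b) (leftCandidates (2 ^ m) a b) a' := by
  obtain ⟨c, hc, hmem, hle, hmax⟩ := hs.exists_tryLeft hs (.inl rfl)
  obtain ⟨a', ha', hmem', hle', hmax'⟩ := hs.exists_tryLeft hc (.inr rfl)
  simp only [neg_one_mul, one_mul, ← sub_eq_add_neg] at hmem hmax hmem' hmax'
  refine ⟨a', ha', ⟨?_, ha'.nonneg, ha'.lt⟩, ?_⟩
  · rcases hmem' with rfl | rfl
    · rcases hmem with rfl | rfl <;> simp
    · simp
  · rintro d ⟨rfl | rfl | rfl, hd₀, hdb⟩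
    · exact hle.trans hle'
    · exact (hmax hd₀ hdb).trans hle'
    · exact hmax' hd₀ hdb

theorem SearchState.Describes.exists_isMaxOn_right (hs : s.Describes x m a b)
    (hb : b ≤ bound * 2 ^ m) :
    ∃ b', (tryRight x m bound s (tryRight x m bound s s (-1)) 1).Describes x m a b' ∧
      b' ∈ rightCandidates (bound * 2 ^ m) (2 ^ m) a b ∧
      IsMaxOn (intervalObjective x a) (rightCandidates (bound * 2 ^ m) (2 ^ m) a b) b' := by
  obtain ⟨c, hc, hmem, hle, hmax⟩ := hs.exists_tryRight (bound := bound) hs (.inl rfl)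
  obtain ⟨b', hb', hmem', hle', hmax'⟩ := hs.exists_tryRight (bound := bound) hc (.inr rfl)
  simp only [neg_one_mul, one_mul, ← sub_eq_add_neg] at hmem hmax hmem' hmax'
  refine ⟨b', hb', ?_, ?_⟩
  · rcases hmem' with rfl | ⟨rfl, hN⟩
    · rcases hmem with rfl | ⟨rfl, hN⟩
      · exact ⟨by simp, hb'.lt, hb⟩
      · exact ⟨by simp, hb'.lt, hN⟩
    · exact ⟨by simp, hb'.lt, hN⟩
  · rintro d ⟨rfl | rfl | rfl, had, hdN⟩
    · exact hle.trans hle'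
    · exact (hmax had hdN).trans hle'
    · exact hmax' had hdN

theorem SearchState.Describes.exists_searchStep {M t : ℕ} (ht : t < M)
    (hs : s.Describes x (M - t) a b) (hb : b ≤ 2 ^ M) :
    ∃ a' b', (searchStep x M t s).Describes x (M - (t + 1)) a' b' ∧
      IsGreedyStep (intervalObjective x) (2 ^ M) (2 ^ (M - (t + 1))) a b a' b' := by
  obtain ⟨m, rfl⟩ : ∃ m, M = t + 1 + m := Nat.exists_eq_add_of_lt ht |>.imp fun k hk => by lia
  have hN : (2 : ℤ) ^ (t + 1 + m) = 2 ^ (t + 1) * 2 ^ m := pow_add 2 (t + 1) m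
  rw [show t + 1 + m - t = m + 1 by lia] at hs
  rw [hN] at hb
  rw [searchStep, show t + 1 + m - t - 1 = m by lia, Nat.add_sub_cancel_left, hN]
  obtain ⟨a', ha', hmem, hmax⟩ := hs.halve.exists_isMaxOn_left
  obtain ⟨b', hb', hmem', hmax'⟩ := ha'.exists_isMaxOn_right hb
  exact ⟨a', b', hb', hmem, hmax, hmem', hmax'⟩

end Search

/-- The left boundary of the interval after `t ≤ M` iterations. -/
noncomputable def leftEnd (x : ℕ → ℝ) (M t : ℕ) : ℤ :=
  (searchState x M t).left * 2 ^ (M - t)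

/-- The right boundary of the interval after `t ≤ M` iterations. -/
noncomputable def rightEnd (x : ℕ → ℝ) (M t : ℕ) : ℤ :=
  (searchState x M t).right * 2 ^ (M - t)

theorem estimatedInterval_eq_Ico (x : ℕ → ℝ) (M t : ℕ) :
    estimatedInterval x M t = Finset.Ico (leftEnd x M (min t M)) (rightEnd x M (min t M)) :=
  rfl

theorem leftEnd_zero (x : ℕ → ℝ) (M : ℕ) : leftEnd x M 0 = 0 := by
  simp [leftEnd, searchState, initState]

theorem rightEnd_zero (x : ℕ → ℝ) (M : ℕ) : rightEnd x M 0 = 2 ^ M := by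
  simp [rightEnd, searchState, initState]

theorem describes_initState (x : ℕ → ℝ) (M : ℕ) : (initState x M).Describes x M 0 (2 ^ M) := by
  have hsum : 2 ^ M * dyadicPower x M 0 = intervalSum x 0 (2 ^ M) := by
    simpa using two_pow_mul_dyadicPower x M 0
  exact
    { left_mul := by simp [initState]
      right_mul := by simp [initState]
      nonneg := le_rfl
      lt := by positivity
      len_eq := by simp [initState]
      len_mul_avg := hsum
      best_eq := by simp [initState, intervalObjective, ← hsum] }

theorem describes_searchState_and_rightEnd_le (x : ℕ → ℝ) {M t : ℕ} (ht : t ≤ M) :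
    (searchState x M t).Describes x (M - t) (leftEnd x M t) (rightEnd x M t) ∧
      rightEnd x M t ≤ 2 ^ M := by
  induction t with
  | zero =>
    rw [leftEnd_zero, rightEnd_zero]
    exact ⟨describes_initState x M, le_rfl⟩
  | succ t ih =>
    obtain ⟨hs, hb⟩ := ih (by lia)
    obtain ⟨a', b', hs', hstep⟩ := hs.exists_searchStep ht hb
    obtain rfl : leftEnd x M (t + 1) = a' := hs'.left_mul
    obtain rfl : rightEnd x M (t + 1) = b' := hs'.right_mul
    exact ⟨hs', hstep.right_mem.2.2⟩

theorem isGreedyStep_searchState (x : ℕ → ℝ) {M t : ℕ} (ht : t < M) :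
    IsGreedyStep (intervalObjective x) (2 ^ M) (2 ^ (M - (t + 1))) (leftEnd x M t)
      (rightEnd x M t) (leftEnd x M (t + 1)) (rightEnd x M (t + 1)) := by
  obtain ⟨hs, hb⟩ := describes_searchState_and_rightEnd_le x ht.le
  obtain ⟨a', b', hs', hstep⟩ := hs.exists_searchStep ht hb
  obtain rfl : leftEnd x M (t + 1) = a' := hs'.left_mul
  obtain rfl : rightEnd x M (t + 1) = b' := hs'.right_mul
  exact hstep

/-! ### Tracking the signal boundaries -/

section MeanPower

variable {γ : ℝ} {A B a b : ℤ}

theorem meanPower_le (hγ : 0 ≤ γ) (S : Finset ℤ) (n : ℕ) : meanPower γ S n ≤ 1 + γ := by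
  unfold meanPower
  split_ifs <;> linarith

theorem meanPower_pos (hγ : 0 ≤ γ) (S : Finset ℤ) (n : ℕ) : 0 < meanPower γ S n := by
  unfold meanPower
  split_ifs <;> linarith

theorem intervalSum_meanPower_le (hγ : 0 ≤ γ) (S : Finset ℤ) (ha : 0 ≤ a) (hab : a ≤ b) :
    intervalSum (meanPower γ S) a b ≤ (1 + γ) * (b - a) := by
  rw [← intervalSum_const (1 + γ) ha hab]
  exact intervalSum_mono ha hab fun n _ _ => meanPower_le hγ S n

theorem intervalSum_meanPower_of_subset (ha : 0 ≤ a) (hab : a ≤ b) (hAa : A ≤ a) (hbB : b ≤ B) :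
    intervalSum (meanPower γ (Finset.Ico A B)) a b = (1 + γ) * (b - a) := by
  rw [← intervalSum_const (1 + γ) ha hab]
  exact intervalSum_congr ha hab fun n h₁ h₂ =>
    if_pos (Finset.mem_Ico.2 ⟨hAa.trans h₁, h₂.trans_le hbB⟩)

theorem intervalSum_meanPower_of_disjoint (ha : 0 ≤ a) (hab : a ≤ b) (h : b ≤ A ∨ B ≤ a) :
    intervalSum (meanPower γ (Finset.Ico A B)) a b = b - a := by
  rw [← one_mul ((b : ℝ) - a), ← intervalSum_const 1 ha hab]
  refine intervalSum_congr ha hab fun n h₁ h₂ => if_neg ?_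
  rw [Finset.mem_Ico]
  lia

end MeanPower

/-- The powers `x` on `[0, N)` have, up to an error `e` in each interval sum, the mean powers of the
signal interval `[A, B)`. -/
structure IsNearSignal (x : ℕ → ℝ) (N A B : ℤ) (γ e : ℝ) : Prop where
  left_nonneg : 0 ≤ A
  left_le_right : A ≤ B
  right_le : B ≤ N
  abs_intervalSum_sub_le : ∀ a b : ℤ, 0 ≤ a → a ≤ b → b ≤ N →
    |intervalSum x a b - intervalSum (meanPower γ (Finset.Ico A B)) a b| ≤ e

namespace IsNearSignal

variable {x : ℕ → ℝ} {N A B a b a' b' c d l : ℤ} {γ e : ℝ}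

theorem error_nonneg (hx : IsNearSignal x N A B γ e) : 0 ≤ e :=
  (abs_nonneg _).trans (hx.abs_intervalSum_sub_le 0 0 le_rfl le_rfl
    ((hx.left_nonneg.trans hx.left_le_right).trans hx.right_le))

theorem intervalSum_le (hx : IsNearSignal x N A B γ e) (hγ : 0 ≤ γ) (ha : 0 ≤ a) (hab : a ≤ b)
    (hb : b ≤ N) : intervalSum x a b ≤ (1 + γ) * (b - a) + e := by
  linarith [(abs_le.1 (hx.abs_intervalSum_sub_le a b ha hab hb)).2,
    intervalSum_meanPower_le hγ (Finset.Ico A B) ha hab]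

theorem le_intervalSum_of_subset (hx : IsNearSignal x N A B γ e) (hAa : A ≤ a) (hab : a ≤ b)
    (hbB : b ≤ B) : (1 + γ) * (b - a) - e ≤ intervalSum x a b := by
  have ha := hx.left_nonneg.trans hAa
  have h := hx.abs_intervalSum_sub_le a b ha hab (hbB.trans hx.right_le)
  rw [intervalSum_meanPower_of_subset ha hab hAa hbB] at h
  linarith [(abs_le.1 h).1]

theorem intervalSum_le_of_disjoint (hx : IsNearSignal x N A B γ e) (ha : 0 ≤ a) (hab : a ≤ b)
    (hb : b ≤ N) (h : b ≤ A ∨ B ≤ a) : intervalSum x a b ≤ b - a + e := by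
  have h' := hx.abs_intervalSum_sub_le a b ha hab hb
  rw [intervalSum_meanPower_of_disjoint ha hab h] at h'
  linarith [(abs_le.1 h').2]

theorem overlap_of_lt_intervalObjective (hx : IsNearSignal x N A B γ e) (ha : 0 ≤ a) (hab : a < b)
    (hb : b ≤ N) (h : e < intervalObjective x a b) : A < b ∧ a < B := by
  by_contra hdisj
  exact h.not_ge (objective_div_le_of_le_add (sub_pos.2 (mod_cast hab)) hx.error_nonneg
    (hx.intervalSum_le_of_disjoint ha hab.le hb (by lia)))

theorem error_lt_of_noise (hx : IsNearSignal x N A B γ e) (hγ : 0 ≤ γ) (hl : 0 ≤ l) (hlN : l ≤ N)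
    {J : ℝ} (hnoise : e * ((1 + γ) * N + e) < l * J) : e < J := by
  have he := hx.error_nonneg
  have hN : (0 : ℝ) ≤ N := mod_cast hl.trans hlN
  by_contra! hJ
  have : l * J ≤ e * ((1 + γ) * N + e) :=
    calc l * J ≤ l * e := by gcongr
      _ ≤ N * e := by gcongr
      _ ≤ e * ((1 + γ) * N + e) := by linarith [mul_nonneg he (mul_nonneg hγ hN), mul_self_nonneg e]
  exact this.not_gt hnoise

theorem intervalObjective_lt_of_remove (hx : IsNearSignal x N A B γ e) (hγ : 0 ≤ γ)
    (ha : 0 ≤ a) (hab : a < b) (hb : b ≤ N) (hc : 0 ≤ c) (hcd : c < d) (hd : d ≤ N)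
    (hdisj : d ≤ A ∨ B ≤ c) (hab' : a' < b') (hlen : b' - a' = b - a - (d - c))
    (hsum : intervalSum x a' b' = intervalSum x a b - intervalSum x c d)
    (hnoise : e * ((1 + γ) * N + e) < (d - c : ℤ) * intervalObjective x a b) :
    intervalObjective x a b < intervalObjective x a' b' := by
  have he := hx.error_nonneg
  have hpos := he.trans_lt (hx.error_lt_of_noise hγ (by lia) (by lia) hnoise)
  have hbN : (b : ℝ) - a ≤ N := mod_cast (by lia : b - a ≤ N)
  have hlen' : (b' : ℝ) - a' = b - a - (d - c) := mod_cast hlen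
  push_cast at hnoise
  rw [intervalObjective, intervalObjective, hlen', hsum]
  refine objective_lt_of_remove (sub_pos.2 (mod_cast hcd)) ?_ he
    (hx.intervalSum_le_of_disjoint hc hcd.le hd hdisj) hpos (lt_of_le_of_lt ?_ hnoise)
  · linarith [sub_pos.2 (Int.cast_lt (R := ℝ).2 hab')]
  · gcongr
    exact (hx.intervalSum_le hγ ha hab.le hb).trans (by gcongr)

theorem intervalObjective_lt_of_add (hx : IsNearSignal x N A B γ e) (hγ : 0 ≤ γ)
    (ha : 0 ≤ a) (hab : a < b) (hb : b ≤ N) (hc : A ≤ c) (hcd : c < d) (hd : d ≤ B)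
    (hab' : b' - a' ≤ N) (hlen : b' - a' = b - a + (d - c))
    (hsum : intervalSum x a' b' = intervalSum x a b + intervalSum x c d)
    (hnoise : e * ((1 + γ) * N + e) < (d - c : ℤ) * intervalObjective x a b) :
    intervalObjective x a b < intervalObjective x a' b' := by
  have he := hx.error_nonneg
  have := hx.left_nonneg
  have := hx.right_le
  have hpos := he.trans_lt (hx.error_lt_of_noise hγ (by lia) (by lia) hnoise)
  have hN : (0 : ℝ) ≤ N := mod_cast (by lia : 0 ≤ N)
  have hbN : (b : ℝ) - a + (d - c) ≤ N := mod_cast hlen ▸ hab'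
  have hlen' : (b' : ℝ) - a' = b - a + (d - c) := mod_cast hlen
  push_cast at hnoise
  rw [intervalObjective, intervalObjective, hlen', hsum]
  refine objective_lt_of_add (sub_pos.2 (mod_cast hab)) (sub_pos.2 (mod_cast hcd)) he
    (hx.intervalSum_le hγ ha hab.le hb) (hx.le_intervalSum_of_subset hc hcd.le hd) hpos
    (lt_of_le_of_lt (mul_le_mul_of_nonneg_left ?_ he) hnoise)
  linarith [mul_nonneg hγ hN]

theorem abs_sub_le_of_isMaxOn_left (hx : IsNearSignal x N A B γ e) (hγ : 0 ≤ γ) (hl : 0 < l)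
    (hlN : l ≤ N) (ha : 0 ≤ a) (hab : a < b) (hb : b ≤ N) (haA : |a - A| ≤ 2 * l)
    (hmem : a' ∈ leftCandidates l a b)
    (hmax : IsMaxOn (fun c => intervalObjective x c b) (leftCandidates l a b) a')
    (hnoise : e * ((1 + γ) * N + e) < l * intervalObjective x a b) : |a' - A| ≤ l := by
  obtain ⟨hcand, ha', hab'⟩ := hmem
  simp only [Set.mem_insert_iff, Set.mem_singleton_iff] at hcand
  rw [abs_le] at haA
  have hA := hx.left_nonneg
  have hle : intervalObjective x a b ≤ intervalObjective x a' b := hmax ⟨by simp, ha, hab⟩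
  have hnoise' : e * ((1 + γ) * N + e) < l * intervalObjective x a' b :=
    hnoise.trans_le (by gcongr)
  obtain ⟨hAb, haB⟩ := hx.overlap_of_lt_intervalObjective ha' hab' hb
    (hx.error_lt_of_noise hγ hl.le hlN hnoise')
  by_contra! hfar
  rcases lt_abs.1 hfar with hright | hleft
  · have hcand' : a' - l ∈ leftCandidates l a b :=
      ⟨by simp only [Set.mem_insert_iff, Set.mem_singleton_iff]; lia, by lia, by lia⟩
    refine (hmax hcand').not_gt (hx.intervalObjective_lt_of_add hγ ha' hab' hb (c := a' - l)
      (d := a') (by lia) (by lia) haB.le (by lia) (by ring) ?_ (by simpa using hnoise'))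
    rw [add_comm, intervalSum_add_adjacent]
  · have hcand' : a' + l ∈ leftCandidates l a b :=
      ⟨by simp only [Set.mem_insert_iff, Set.mem_singleton_iff]; lia, by lia, by lia⟩
    refine (hmax hcand').not_gt (hx.intervalObjective_lt_of_remove hγ ha' hab' hb (c := a')
      (d := a' + l) ha' (by lia) (by lia) (.inl (by lia)) (by lia) (by ring) ?_
      (by simpa using hnoise'))
    rw [← intervalSum_add_adjacent x a' (a' + l) b, add_sub_cancel_left]

theorem abs_sub_le_of_isMaxOn_right (hx : IsNearSignal x N A B γ e) (hγ : 0 ≤ γ) (hl : 0 < l)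
    (hlN : l ≤ N) (ha : 0 ≤ a) (hab : a < b) (hb : b ≤ N) (hbB : |b - B| ≤ 2 * l)
    (hmem : b' ∈ rightCandidates N l a b)
    (hmax : IsMaxOn (intervalObjective x a) (rightCandidates N l a b) b')
    (hnoise : e * ((1 + γ) * N + e) < l * intervalObjective x a b) : |b' - B| ≤ l := by
  obtain ⟨hcand, hab', hb'⟩ := hmem
  simp only [Set.mem_insert_iff, Set.mem_singleton_iff] at hcand
  rw [abs_le] at hbB
  have hB := hx.right_le
  have hle : intervalObjective x a b ≤ intervalObjective x a b' := hmax ⟨by simp, hab, hb⟩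
  have hnoise' : e * ((1 + γ) * N + e) < l * intervalObjective x a b' :=
    hnoise.trans_le (by gcongr)
  obtain ⟨hAb, haB⟩ := hx.overlap_of_lt_intervalObjective ha hab' hb'
    (hx.error_lt_of_noise hγ hl.le hlN hnoise')
  by_contra! hfar
  rcases lt_abs.1 hfar with hright | hleft
  · have hcand' : b' - l ∈ rightCandidates N l a b :=
      ⟨by simp only [Set.mem_insert_iff, Set.mem_singleton_iff]; lia, by lia, by lia⟩
    refine (hmax hcand').not_gt (hx.intervalObjective_lt_of_remove hγ ha hab' hb' (c := b' - l)
      (d := b') (by lia) (by lia) hb' (.inr (by lia)) (by lia) (by ring) ?_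
      (by simpa using hnoise'))
    rw [← intervalSum_add_adjacent x a (b' - l) b', add_sub_cancel_right]
  · have hcand' : b' + l ∈ rightCandidates N l a b :=
      ⟨by simp only [Set.mem_insert_iff, Set.mem_singleton_iff]; lia, by lia, by lia⟩
    refine (hmax hcand').not_gt (hx.intervalObjective_lt_of_add hγ ha hab' hb' (c := b')
      (d := b' + l) hAb.le (by lia) (by lia) (by lia) (by ring) ?_ (by simpa using hnoise'))
    rw [intervalSum_add_adjacent]

theorem abs_sub_le_of_isGreedyStep (hx : IsNearSignal x N A B γ e) (hγ : 0 ≤ γ) (hl : 0 < l)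
    (hlN : l ≤ N) (ha : 0 ≤ a) (hab : a < b) (hb : b ≤ N)
    (hstep : IsGreedyStep (intervalObjective x) N l a b a' b')
    (hnoise : e * ((1 + γ) * N + e) < l * intervalObjective x a b)
    (haA : |a - A| ≤ 2 * l) (hbB : |b - B| ≤ 2 * l) : |a' - A| ≤ l ∧ |b' - B| ≤ l := by
  have hle : intervalObjective x a b ≤ intervalObjective x a' b :=
    hstep.isMaxOn_left ⟨by simp, ha, hab⟩
  have hnoise' : e * ((1 + γ) * N + e) < l * intervalObjective x a' b :=
    hnoise.trans_le (by gcongr)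
  exact ⟨hx.abs_sub_le_of_isMaxOn_left hγ hl hlN ha hab hb haA hstep.left_mem hstep.isMaxOn_left
      hnoise,
    hx.abs_sub_le_of_isMaxOn_right hγ hl hlN hstep.left_mem.2.1 hstep.left_mem.2.2 hb hbB
      hstep.right_mem hstep.isMaxOn_right hnoise'⟩

end IsNearSignal

theorem IsGreedyStep.le {J : ℤ → ℤ → ℝ} {N l a b a' b' : ℤ} (h : IsGreedyStep J N l a b a' b')
    (ha : 0 ≤ a) (hab : a < b) (hb : b ≤ N) : J a b ≤ J a' b' :=
  (h.isMaxOn_left ⟨by simp, ha, hab⟩).trans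
    (h.isMaxOn_right ⟨by simp, h.left_mem.2.2, hb⟩)

theorem IsGreedyStep.abs_sub_le {J : ℤ → ℤ → ℝ} {N l a b a' b' : ℤ}
    (h : IsGreedyStep J N l a b a' b') (hl : 0 ≤ l) : |a' - a| ≤ l ∧ |b' - b| ≤ l := by
  obtain ⟨ha', -⟩ := h.left_mem
  obtain ⟨hb', -⟩ := h.right_mem
  simp only [Set.mem_insert_iff, Set.mem_singleton_iff] at ha' hb'
  simp only [abs_le]
  lia

-- The bound is the sum of the step lengths `2 ^ (M - T - 1), …, 2 ^ (M - t)`.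
theorem abs_ends_sub_ends_le (x : ℕ → ℝ) {M T t : ℕ} (hT : T ≤ t) (ht : t ≤ M) :
    |leftEnd x M t - leftEnd x M T| ≤ 2 ^ (M - T) - 2 ^ (M - t) ∧
      |rightEnd x M t - rightEnd x M T| ≤ 2 ^ (M - T) - 2 ^ (M - t) := by
  induction t, hT using Nat.le_induction with
  | base => simp
  | succ t hTt ih =>
    have hdouble : (2 : ℤ) ^ (M - t) = 2 * 2 ^ (M - (t + 1)) := by
      rw [← pow_succ']; congr 1; lia
    obtain ⟨hleft, hright⟩ := (isGreedyStep_searchState x ht).abs_sub_le (by positivity)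
    obtain ⟨hleft', hright'⟩ := ih (by lia)
    constructor
    · refine (abs_sub_le _ (leftEnd x M t) _).trans ?_
      lia
    · refine (abs_sub_le _ (rightEnd x M t) _).trans ?_
      lia

namespace IsNearSignal

variable {x : ℕ → ℝ} {M T t : ℕ} {A B : ℤ} {γ e : ℝ}

theorem le_intervalObjective_and_abs_ends_sub_le (hx : IsNearSignal x (2 ^ M) A B γ e)
    (hγ : 0 ≤ γ) (hT : T ≤ M)
    (hnoise : e * ((1 + γ) * 2 ^ M + e) < 2 ^ (M - T) * intervalObjective x 0 (2 ^ M))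
    (ht : t ≤ T) :
    intervalObjective x 0 (2 ^ M) ≤ intervalObjective x (leftEnd x M t) (rightEnd x M t) ∧
      |leftEnd x M t - A| ≤ 2 ^ (M - t) ∧ |rightEnd x M t - B| ≤ 2 ^ (M - t) := by
  induction t with
  | zero =>
    have := hx.left_nonneg
    have := hx.left_le_right
    have := hx.right_le
    rw [leftEnd_zero, rightEnd_zero, Nat.sub_zero, abs_le, abs_le]
    exact ⟨le_rfl, by lia, by lia⟩
  | succ t ih =>
    obtain ⟨hJ, hleft, hright⟩ := ih (by lia)
    obtain ⟨hs, hb⟩ := describes_searchState_and_rightEnd_le x (show t ≤ M by lia)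
    have hstep := isGreedyStep_searchState x (show t < M by lia)
    have hdouble : (2 : ℤ) ^ (M - t) = 2 * 2 ^ (M - (t + 1)) := by
      rw [← pow_succ']; congr 1; lia
    have hnoise' : e * ((1 + γ) * (2 ^ M : ℤ) + e) < (2 ^ (M - (t + 1)) : ℤ) *
        intervalObjective x (leftEnd x M t) (rightEnd x M t) := by
      push_cast
      have hpos : 0 < intervalObjective x 0 (2 ^ M) :=
        hx.error_nonneg.trans_lt (hx.error_lt_of_noise hγ (l := 2 ^ (M - T)) (by positivity)
          (pow_le_pow_right₀ one_le_two (Nat.sub_le M T)) (mod_cast hnoise))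
      refine hnoise.trans_le ?_
      gcongr
      exact one_le_two
    rw [hdouble] at hleft hright
    exact ⟨hJ.trans (hstep.le hs.nonneg hs.lt hb),
      hx.abs_sub_le_of_isGreedyStep hγ (by positivity)
        (pow_le_pow_right₀ one_le_two (Nat.sub_le M _)) hs.nonneg hs.lt hb hstep hnoise' hleft
        hright⟩

theorem abs_ends_sub_le (hx : IsNearSignal x (2 ^ M) A B γ e) (hγ : 0 ≤ γ) (hTt : T ≤ t)
    (ht : t ≤ M)
    (hnoise : e * ((1 + γ) * 2 ^ M + e) < 2 ^ (M - T) * intervalObjective x 0 (2 ^ M)) :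
    |leftEnd x M t - A| ≤ 2 * 2 ^ (M - T) ∧ |rightEnd x M t - B| ≤ 2 * 2 ^ (M - T) := by
  obtain ⟨-, hleft, hright⟩ := hx.le_intervalObjective_and_abs_ends_sub_le hγ (hTt.trans ht) hnoise
    le_rfl
  obtain ⟨hleft', hright'⟩ := abs_ends_sub_ends_le x hTt ht
  have hpos : (0 : ℤ) < 2 ^ (M - t) := by positivity
  constructor
  · refine (abs_sub_le _ (leftEnd x M T) _).trans ?_
    lia
  · refine (abs_sub_le _ (rightEnd x M T) _).trans ?_
    lia

theorem le_intervalObjective_univ (hx : IsNearSignal x (2 ^ M) A B γ e) {z : ℝ} (hz : 1 ≤ z)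
    (hzs : 2 ^ M * z ≤ 2 ^ M + γ * (B - A) - e) :
    2 ^ M * (z - 1 - Real.log z) ≤ intervalObjective x 0 (2 ^ M) := by
  have hA := hx.left_nonneg
  have hAB := hx.left_le_right
  have hBN := hx.right_le
  have hmean : intervalSum (meanPower γ (Finset.Ico A B)) 0 (2 ^ M) = 2 ^ M + γ * (B - A) := by
    rw [← intervalSum_add_adjacent _ 0 A (2 ^ M), ← intervalSum_add_adjacent _ A B (2 ^ M),
      intervalSum_meanPower_of_disjoint le_rfl hA (.inl le_rfl),
      intervalSum_meanPower_of_subset hA hAB le_rfl le_rfl,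
      intervalSum_meanPower_of_disjoint (hA.trans hAB) hBN (.inr le_rfl)]
    push_cast
    ring
  have hsum : 2 ^ M * z ≤ intervalSum x 0 (2 ^ M) := by
    have h := hx.abs_intervalSum_sub_le 0 (2 ^ M) le_rfl (by positivity) le_rfl
    rw [hmean] at h
    linarith [(abs_le.1 h).1]
  simpa [intervalObjective] using le_objective_div (L := 2 ^ M) (by positivity) hz hsum

end IsNearSignal

/-! ### Consistency for powers that are nearly a signal -/

theorem IoU_le_one (S T : Finset ℤ) : IoU S T ≤ 1 :=
  div_le_one_of_le₀ (mod_cast Finset.card_le_card Finset.inter_subset_union) (by positivity)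

theorem one_sub_IoU_le (S : Finset ℤ) {T : Finset ℤ} (hT : T.Nonempty) :
    1 - IoU S T ≤ ((symmDiff S T).card : ℝ) / T.card := by
  have hcard : ((S ∩ T).card : ℝ) + (symmDiff S T).card = (S ∪ T).card := by
    have h : symmDiff S T = (S ∪ T) \ (S ∩ T) := symmDiff_eq_sup_sdiff_inf S T
    rw [h, add_comm]
    exact mod_cast Finset.card_sdiff_add_card_eq_card Finset.inter_subset_union
  have hT₀ : (0 : ℝ) < T.card := mod_cast hT.card_pos
  have hle : (T.card : ℝ) ≤ (S ∪ T).card := mod_cast Finset.card_le_card Finset.subset_union_right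
  calc 1 - IoU S T = (symmDiff S T).card / (S ∪ T).card := by
        rw [IoU, one_sub_div (hT₀.trans_le hle).ne', ← hcard, add_sub_cancel_left]
    _ ≤ (symmDiff S T).card / T.card := by gcongr

theorem card_symmDiff_Ico_le (a b A B : ℤ) :
    ((symmDiff (Finset.Ico a b) (Finset.Ico A B)).card : ℤ) ≤ |a - A| + |b - B| := by
  have hsub : symmDiff (Finset.Ico a b) (Finset.Ico A B) ⊆
      Finset.Ico (min a A) (max a A) ∪ Finset.Ico (min b B) (max b B) := by
    intro n
    simp only [Finset.mem_symmDiff, Finset.mem_union, Finset.mem_Ico]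
    lia
  have hcard (u v : ℤ) : ((Finset.Ico (min u v) (max u v)).card : ℤ) = |u - v| := by
    rw [Int.card_Ico, Int.toNat_of_nonneg (sub_nonneg.2 min_le_max), max_sub_min_eq_abs']
  rw [← hcard, ← hcard]
  exact_mod_cast (Finset.card_le_card hsub).trans (Finset.card_union_le _ _)

theorem one_sub_IoU_Ico_le {a b A B : ℤ} (hAB : A < B) :
    1 - IoU (Finset.Ico a b) (Finset.Ico A B) ≤
      ((|a - A| + |b - B| : ℤ) : ℝ) / ((B - A : ℤ) : ℝ) := by
  have hcard : ((Finset.Ico A B).card : ℝ) = ((B - A : ℤ) : ℝ) := by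
    rw [Int.card_Ico]
    exact_mod_cast Int.toNat_of_nonneg (sub_nonneg.2 hAB.le)
  have : (0 : ℝ) < ((B - A : ℤ) : ℝ) := mod_cast sub_pos.2 hAB
  refine (one_sub_IoU_le _ (Finset.nonempty_Ico.2 hAB)).trans ?_
  rw [hcard]
  gcongr
  exact_mod_cast card_symmDiff_Ico_le a b A B

namespace IsNearSignal

variable {x : ℕ → ℝ} {M T t : ℕ} {A B : ℤ} {γ c δ : ℝ}

theorem noise_lt (hx : IsNearSignal x (2 ^ M) A B γ (δ * 2 ^ M)) (hγ : 0 ≤ γ) (hc : 0 ≤ c)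
    (hT : T ≤ M) (hAB : c * 2 ^ M ≤ B - A) (hδ : δ ≤ γ * c / 2)
    (hδT : δ * (1 + γ + δ) < (1 / 2) ^ T * (γ * c / 2 - Real.log (1 + γ * c / 2))) :
    δ * 2 ^ M * ((1 + γ) * 2 ^ M + δ * 2 ^ M) < 2 ^ (M - T) * intervalObjective x 0 (2 ^ M) := by
  have hgain : 2 ^ M * (1 + γ * c / 2) ≤ 2 ^ M + γ * (B - A) - δ * 2 ^ M := by
    linarith [mul_le_mul_of_nonneg_left hAB hγ,
      mul_le_mul_of_nonneg_right hδ (show (0 : ℝ) ≤ 2 ^ M by positivity)]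
  have hJ := hx.le_intervalObjective_univ (by linarith [mul_nonneg hγ hc]) hgain
  rw [add_sub_cancel_left] at hJ
  have hpow : (2 : ℝ) ^ M * (1 / 2) ^ T = 2 ^ (M - T) := by
    rw [pow_sub₀ 2 two_ne_zero hT, one_div, inv_pow]
  calc δ * 2 ^ M * ((1 + γ) * 2 ^ M + δ * 2 ^ M)
      = 2 ^ M * 2 ^ M * (δ * (1 + γ + δ)) := by ring
    _ < 2 ^ M * 2 ^ M * ((1 / 2) ^ T * (γ * c / 2 - Real.log (1 + γ * c / 2))) := by gcongr
    _ = 2 ^ (M - T) * (2 ^ M * (γ * c / 2 - Real.log (1 + γ * c / 2))) := by rw [← hpow]; ring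
    _ ≤ 2 ^ (M - T) * intervalObjective x 0 (2 ^ M) := by gcongr

theorem one_sub_IoU_estimatedInterval_le {e : ℝ} (hx : IsNearSignal x (2 ^ M) A B γ e)
    (hγ : 0 ≤ γ) (hc : 0 < c) (hTM : T ≤ M) (hTt : T ≤ t) (hAB : c * 2 ^ M ≤ B - A)
    (hnoise : e * ((1 + γ) * 2 ^ M + e) < 2 ^ (M - T) * intervalObjective x 0 (2 ^ M)) :
    1 - IoU (estimatedInterval x M t) (Finset.Ico A B) ≤ 4 / c * (1 / 2) ^ T := by
  have hlen : (0 : ℝ) < B - A := lt_of_lt_of_le (by positivity) hAB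
  obtain ⟨hleft, hright⟩ := hx.abs_ends_sub_le hγ (le_min hTt hTM) (min_le_right t M) hnoise
  have hdist : |leftEnd x M (min t M) - A| + |rightEnd x M (min t M) - B| ≤ 4 * 2 ^ (M - T) := by
    linarith
  have hpow : (2 : ℝ) ^ (M - T) = 2 ^ M * (1 / 2) ^ T := by
    rw [pow_sub₀ 2 two_ne_zero hTM, one_div, inv_pow]
  rw [estimatedInterval_eq_Ico]
  calc 1 - IoU (Finset.Ico _ _) (Finset.Ico A B)
      ≤ ((|leftEnd x M (min t M) - A| + |rightEnd x M (min t M) - B| : ℤ) : ℝ) /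
          ((B - A : ℤ) : ℝ) := one_sub_IoU_Ico_le (by exact_mod_cast sub_pos.1 hlen)
    _ ≤ ((4 * 2 ^ (M - T) : ℤ) : ℝ) / (c * 2 ^ M) := by
      gcongr
      exact_mod_cast hAB
    _ = 4 / c * (1 / 2) ^ T := by push_cast; rw [hpow]; field_simp

end IsNearSignal

open Filter Topology in
theorem tendsto_IoU_of_isNearSignal {x : ℕ → ℕ → ℝ} {A B : ℕ → ℤ} {c γ : ℝ} (hc : 0 < c)
    (hγ : 0 < γ) (hAB : ∀ᶠ M in atTop, c * 2 ^ M ≤ B M - A M)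
    (hx : ∀ δ > 0, ∀ᶠ M in atTop, IsNearSignal (x M) (2 ^ M) (A M) (B M) γ (δ * 2 ^ M)) :
    Tendsto (fun p : ℕ × ℕ => IoU (estimatedInterval (x p.1) p.1 p.2) (Finset.Ico (A p.1) (B p.1)))
      (atTop ×ˢ atTop) (𝓝 1) := by
  have hj : 0 < γ * c / 2 - Real.log (1 + γ * c / 2) := by
    have := Real.log_lt_sub_one_of_pos (show 0 < 1 + γ * c / 2 by positivity)
      (by simp [hγ.ne', hc.ne'])
    linarith
  refine tendsto_order.2 ⟨fun r hr => ?_, fun r hr =>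
    .of_forall fun p => (IoU_le_one _ _).trans_lt hr⟩
  obtain ⟨T, hT⟩ : ∃ T : ℕ, (1 / 2 : ℝ) ^ T < (1 - r) / (4 / c) :=
    exists_pow_lt_of_lt_one (div_pos (sub_pos.2 hr) (by positivity)) (by norm_num)
  obtain ⟨δ, ⟨hδT, hδ⟩, hδ₀⟩ : ∃ δ, (δ * (1 + γ + δ) <
      (1 / 2) ^ T * (γ * c / 2 - Real.log (1 + γ * c / 2)) ∧ δ < γ * c / 2) ∧ 0 < δ := by
    have hcont : Tendsto (fun δ : ℝ => δ * (1 + γ + δ)) (𝓝[>] 0) (𝓝 0) :=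
      tendsto_nhdsWithin_of_tendsto_nhds (Continuous.tendsto' (by fun_prop) _ _ (by simp))
    exact (((hcont.eventually_lt_const (by positivity)).and
      (eventually_nhdsWithin_of_eventually_nhds (eventually_lt_nhds (by positivity)))).and
      self_mem_nhdsWithin).exists
  filter_upwards [((hAB.and (hx δ hδ₀)).and (eventually_ge_atTop T)).prod_mk
    (eventually_ge_atTop T)] with p ⟨⟨⟨hlen, hnear⟩, hTM⟩, hTt⟩
  have hIoU := hnear.one_sub_IoU_estimatedInterval_le hγ.le hc hTM hTt hlen
    (hnear.noise_lt hγ.le hc.le hTM hlen hδ.le hδT)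
  have hr' : 4 / c * (1 / 2) ^ T < 1 - r := by
    rwa [lt_div_iff₀' (by positivity)] at hT
  linarith

section Probability

open MeasureTheory ProbabilityTheory Filter Topology

/-! ### A uniform strong law of large numbers for triangular arrays -/

section Concentration

variable {Ω : Type*} [MeasurableSpace Ω] {μ : Measure Ω}

theorem measure_le_abs_sum_sub_integral_le [IsFiniteMeasure μ] {ι : Type*} {Y : ι → Ω → ℝ}
    {s : Finset ι} {V c : ℝ}
    (hY : ∀ i ∈ s, MemLp (Y i) 2 μ) (hvar : ∀ i ∈ s, variance (Y i) μ ≤ V)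
    (hindep : (s : Set ι).Pairwise fun i j => IndepFun (Y i) (Y j) μ) (hc : 0 < c) :
    μ {ω | c ≤ |∑ i ∈ s, (Y i ω - ∫ ω', Y i ω' ∂μ)|} ≤ ENNReal.ofReal (s.card * V / c ^ 2) := by
  have hmean : ∫ ω, (∑ i ∈ s, Y i) ω ∂μ = ∑ i ∈ s, ∫ ω, Y i ω ∂μ := by
    simp_rw [Finset.sum_apply]
    exact integral_finsetSum _ fun i hi => (hY i hi).integrable one_le_two
  have hvarsum : variance (∑ i ∈ s, Y i) μ ≤ s.card * V := by
    rw [IndepFun.variance_sum hY hindep, ← nsmul_eq_mul]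
    exact Finset.sum_le_card_nsmul _ _ _ hvar
  have h := meas_ge_le_variance_div_sq (memLp_finsetSum' s hY) hc
  simp_rw [hmean, Finset.sum_apply, ← Finset.sum_sub_distrib] at h
  exact h.trans (by gcongr)

/-- A triangular array of square-integrable random variables: the variables `X M n`, `n < N M`, of
each row `M` are pairwise independent and have variances at most `V`. -/
structure IsPairwiseIndepArray (μ : Measure Ω) (N : ℕ → ℕ) (V : ℝ) (X : ℕ → ℕ → Ω → ℝ) : Prop where
  memLp : ∀ M, ∀ n < N M, MemLp (X M n) 2 μ
  variance_le : ∀ M, ∀ n < N M, variance (X M n) μ ≤ V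
  indepFun : ∀ M, ∀ i < N M, ∀ j < N M, i ≠ j → IndepFun (X M i) (X M j) μ

namespace IsPairwiseIndepArray

variable {N : ℕ → ℕ} {V ε : ℝ} {X : ℕ → ℕ → Ω → ℝ}

theorem variance_bound_nonneg (hX : IsPairwiseIndepArray μ N V X) (hN : ∀ M, 0 < N M) : 0 ≤ V :=
  (variance_nonneg _ _).trans (hX.variance_le 0 0 (hN 0))

variable [IsProbabilityMeasure μ]

theorem abs_sub_integral (hX : IsPairwiseIndepArray μ N V X) :
    IsPairwiseIndepArray μ N V fun M n ω => |X M n ω - ∫ ω', X M n ω' ∂μ| where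
  memLp M n hn := ((hX.memLp M n hn).sub (memLp_const _)).abs
  variance_le M n hn := by
    have hmeas := (hX.memLp M n hn).aestronglyMeasurable
    refine (variance_le_expectation_sq (by fun_prop)).trans
      (le_of_eq_of_le ?_ (hX.variance_le M n hn))
    rw [variance_eq_integral hmeas.aemeasurable]
    simp
  indepFun M i hi j hj hij := (hX.indepFun M i hi j hj hij).comp
    (φ := fun y => |y - ∫ ω', X M i ω' ∂μ|) (ψ := fun y => |y - ∫ ω', X M j ω' ∂μ|)
    (by fun_prop) (by fun_prop)

theorem integral_abs_sub_integral_le (hX : IsPairwiseIndepArray μ N V X) {M n : ℕ} (hn : n < N M) :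
    ∫ ω, |X M n ω - ∫ ω', X M n ω' ∂μ| ∂μ ≤ 1 + V := by
  have hL2 : MemLp (fun ω => X M n ω - ∫ ω', X M n ω' ∂μ) 2 μ :=
    (hX.memLp M n hn).sub (memLp_const _)
  calc ∫ ω, |X M n ω - ∫ ω', X M n ω' ∂μ| ∂μ
      ≤ ∫ ω, (1 + (X M n ω - ∫ ω', X M n ω' ∂μ) ^ 2) ∂μ := by
        refine integral_mono (hL2.abs.integrable one_le_two)
          ((integrable_const 1).add hL2.integrable_sq) fun ω => ?_
        generalize X M n ω - ∫ ω', X M n ω' ∂μ = y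
        change |y| ≤ 1 + y ^ 2
        nlinarith [sq_abs y, sq_nonneg (|y| - 1)]
    _ = 1 + variance (X M n) μ := by
        rw [integral_add (integrable_const 1) hL2.integrable_sq,
          variance_eq_integral (hX.memLp M n hn).aestronglyMeasurable.aemeasurable]
        simp
    _ ≤ 1 + V := by gcongr; exact hX.variance_le M n hn

theorem ae_eventually_abs_sum_lt (hX : IsPairwiseIndepArray μ N V X) (hN : ∀ M, 0 < N M)
    (hNsum : Summable fun M => (N M : ℝ)⁻¹) {s : ℕ → Finset ℕ} (hs : ∀ M, s M ⊆ Finset.range (N M))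
    (hε : 0 < ε) :
    ∀ᵐ ω ∂μ, ∀ᶠ M in atTop, |∑ n ∈ s M, (X M n ω - ∫ ω', X M n ω' ∂μ)| < ε * N M := by
  have hlt {M n : ℕ} (hn : n ∈ s M) : n < N M := Finset.mem_range.1 (hs M hn)
  have hbound (M : ℕ) : μ {ω | ε * N M ≤ |∑ n ∈ s M, (X M n ω - ∫ ω', X M n ω' ∂μ)|} ≤
      ENNReal.ofReal (V / ε ^ 2 * (N M : ℝ)⁻¹) := by
    have hNpos : (0 : ℝ) < N M := mod_cast hN M
    refine (measure_le_abs_sum_sub_integral_le (fun n hn => hX.memLp M n (hlt hn))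
      (fun n hn => hX.variance_le M n (hlt hn))
      (fun i hi j hj => hX.indepFun M i (hlt hi) j (hlt hj)) (by positivity)).trans ?_
    have hcard : ((s M).card : ℝ) ≤ N M := mod_cast (Finset.card_le_card (hs M)).trans_eq (by simp)
    have := hX.variance_bound_nonneg hN
    refine ENNReal.ofReal_le_ofReal ?_
    calc (s M).card * V / (ε * N M) ^ 2 ≤ N M * V / (ε * N M) ^ 2 := by gcongr
      _ = V / ε ^ 2 * (N M : ℝ)⁻¹ := by field_simp
  have hfinite := (hNsum.mul_left (V / ε ^ 2)).tsum_ofReal_ne_top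
  filter_upwards [ae_eventually_notMem (ne_top_of_le_ne_top hfinite (ENNReal.tsum_le_tsum hbound))]
    with ω hω
  simpa using hω

end IsPairwiseIndepArray

end Concentration

section UniformLaw

theorem abs_sum_range_le_of_grid (x : ℕ → ℝ) {k N : ℕ} (hk : k ≤ N) {d : ℕ} (hd : 0 < d) :
    |∑ n ∈ Finset.range k, x n| ≤ |∑ n ∈ Finset.range (min (k / d * d) N), x n| +
      ∑ n ∈ Finset.Ico (k / d * d) (min ((k / d + 1) * d) N), |x n| := by
  have hle : k / d * d ≤ k := Nat.div_mul_le_self k d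
  have hlt : k < (k / d + 1) * d := Nat.lt_mul_of_div_lt (Nat.lt_succ_self _) hd
  rw [min_eq_left (hle.trans hk), ← Finset.sum_range_add_sum_Ico x hle]
  calc |∑ n ∈ Finset.range (k / d * d), x n + ∑ n ∈ Finset.Ico (k / d * d) k, x n|
      ≤ |∑ n ∈ Finset.range (k / d * d), x n| + ∑ n ∈ Finset.Ico (k / d * d) k, |x n| :=
        (abs_add_le _ _).trans (by gcongr; exact Finset.abs_sum_le_sum_abs _ _)
    _ ≤ _ := by
        gcongr
        exact le_min hlt.le hk

namespace IsPairwiseIndepArray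

variable {Ω : Type*} [MeasurableSpace Ω] {μ : Measure Ω} [IsProbabilityMeasure μ]
  {N : ℕ → ℕ} {V ε : ℝ} {X : ℕ → ℕ → Ω → ℝ}

theorem ae_eventually_sum_abs_lt (hX : IsPairwiseIndepArray μ N V X) (hN : ∀ M, 0 < N M)
    (hNsum : Summable fun M => (N M : ℝ)⁻¹) {s : ℕ → Finset ℕ} (hs : ∀ M, s M ⊆ Finset.range (N M))
    (hε : 0 < ε) :
    ∀ᵐ ω ∂μ, ∀ᶠ M in atTop,
      ∑ n ∈ s M, |X M n ω - ∫ ω', X M n ω' ∂μ| < ε * N M + (s M).card * (1 + V) := by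
  filter_upwards [hX.abs_sub_integral.ae_eventually_abs_sum_lt hN hNsum hs hε] with ω hω
  filter_upwards [hω] with M hM
  have hmean : ∑ n ∈ s M, ∫ ω, |X M n ω - ∫ ω', X M n ω' ∂μ| ∂μ ≤ (s M).card * (1 + V) := by
    rw [← nsmul_eq_mul]
    exact Finset.sum_le_card_nsmul _ _ _ fun n hn =>
      hX.integral_abs_sub_integral_le (Finset.mem_range.1 (hs M hn))
  rw [Finset.sum_sub_distrib] at hM
  linarith [(abs_lt.1 hM).2]

-- The grid of the multiples of `N M / Q + 1` has at most `Q` points for every `M`, so the law of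
-- large numbers is only needed for finitely many sequences of index sets.
theorem ae_eventually_forall_abs_sum_range_lt_of_grid (hX : IsPairwiseIndepArray μ N V X)
    (hN : ∀ M, 0 < N M) (hNsum : Summable fun M => (N M : ℝ)⁻¹) {Q : ℕ} (hQ : 0 < Q) (hε : 0 < ε) :
    ∀ᵐ ω ∂μ, ∀ᶠ M in atTop, ∀ k ≤ N M,
      |∑ n ∈ Finset.range k, (X M n ω - ∫ ω', X M n ω' ∂μ)| <
        2 * ε * N M + (N M / Q + 1) * (1 + V) := by
  set d : ℕ → ℕ := fun M => N M / Q + 1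
  set cell : ℕ → ℕ → Finset ℕ := fun i M => Finset.Ico (i * d M) (min ((i + 1) * d M) (N M))
  have hprefix : ∀ᵐ ω ∂μ, ∀ i : ℕ, ∀ᶠ M in atTop,
      |∑ n ∈ Finset.range (min (i * d M) (N M)), (X M n ω - ∫ ω', X M n ω' ∂μ)| < ε * N M :=
    ae_all_iff.2 fun i => hX.ae_eventually_abs_sum_lt hN hNsum
      (fun M => Finset.range_mono (min_le_right _ _)) hε
  have hcell : ∀ᵐ ω ∂μ, ∀ i : ℕ, ∀ᶠ M in atTop,
      ∑ n ∈ cell i M, |X M n ω - ∫ ω', X M n ω' ∂μ| < ε * N M + (cell i M).card * (1 + V) :=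
    ae_all_iff.2 fun i => hX.ae_eventually_sum_abs_lt hN hNsum
      (fun M n hn => Finset.mem_range.2 ((Finset.mem_Ico.1 hn).2.trans_le (min_le_right _ _))) hε
  have hcard (i M : ℕ) : ((cell i M).card : ℝ) * (1 + V) ≤ (N M / Q + 1) * (1 + V) := by
    have hV : 0 ≤ V := hX.variance_bound_nonneg hN
    have hle : (cell i M).card ≤ d M := by
      rw [Nat.card_Ico, add_one_mul]
      lia
    gcongr
    calc ((cell i M).card : ℝ) ≤ (d M : ℝ) := mod_cast hle
      _ ≤ N M / Q + 1 := by
        rw [Nat.cast_add_one]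
        gcongr
        exact Nat.cast_div_le
  filter_upwards [hprefix, hcell] with ω hωprefix hωcell
  filter_upwards [(Finset.eventually_all (Finset.range Q)).2 fun i _ => hωprefix i,
    (Finset.eventually_all (Finset.range Q)).2 fun i _ => hωcell i] with M hMprefix hMcell k hk
  have hi : k / d M ∈ Finset.range Q := Finset.mem_range.2 <|
    Nat.div_lt_of_lt_mul <| hk.trans_lt <| by
      rw [mul_comm]; exact Nat.lt_mul_div_succ (N M) hQ
  linarith [abs_sum_range_le_of_grid (fun n => X M n ω - ∫ ω', X M n ω' ∂μ) hk
    (Nat.succ_pos (N M / Q)), hMprefix _ hi, hMcell _ hi, hcard (k / d M) M]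

theorem ae_forall_eventually_forall_abs_sum_range_le (hX : IsPairwiseIndepArray μ N V X)
    (hN : ∀ M, 0 < N M) (hNsum : Summable fun M => (N M : ℝ)⁻¹) :
    ∀ᵐ ω ∂μ, ∀ ε > 0, ∀ᶠ M in atTop, ∀ k ≤ N M,
      |∑ n ∈ Finset.range k, (X M n ω - ∫ ω', X M n ω' ∂μ)| ≤ ε * N M := by
  have hV : 0 ≤ V := hX.variance_bound_nonneg hN
  filter_upwards [ae_all_iff.2 fun j : ℕ =>
    hX.ae_eventually_forall_abs_sum_range_lt_of_grid hN hNsum j.succ_pos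
      (Nat.one_div_pos_of_nat (α := ℝ) (n := j))] with ω hω ε hε
  obtain ⟨j, hj⟩ := exists_nat_gt ((4 + 2 * V) / ε)
  rw [div_lt_iff₀ hε] at hj
  have hNj : ∀ᶠ M in atTop, ((j : ℝ) + 1) * (N M : ℝ)⁻¹ < 1 := by
    have h := hNsum.tendsto_atTop_zero.const_mul ((j : ℝ) + 1)
    rw [mul_zero] at h
    exact h.eventually_lt_const one_pos
  filter_upwards [hω j, hNj] with M hM hNj k hk
  have hNpos : (0 : ℝ) < N M := mod_cast hN M
  have hone : 1 ≤ N M / ((j : ℝ) + 1) := by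
    rw [one_le_div (by positivity)]
    rw [← div_eq_mul_inv, div_lt_one hNpos] at hNj
    exact hNj.le
  calc |∑ n ∈ Finset.range k, (X M n ω - ∫ ω', X M n ω' ∂μ)|
      ≤ 2 * (1 / (j + 1)) * N M + (N M / (j + 1) + 1) * (1 + V) := mod_cast (hM k hk).le
    _ ≤ 2 * (1 / (j + 1)) * N M + (N M / (j + 1) + N M / (j + 1)) * (1 + V) := by gcongr
    _ = (4 + 2 * V) / (j + 1) * N M := by ring
    _ ≤ ε * N M := by
      gcongr
      rw [div_le_iff₀ (by positivity)]
      linarith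

end IsPairwiseIndepArray

end UniformLaw

/-! ### Moments of exponential variables -/

section Moments

theorem gammaPDFReal_mul_pow {a r x : ℝ} (ha : 0 < a) (hr : 0 < r) (hx : x ≠ 0) (k : ℕ) :
    gammaPDFReal a r x * x ^ k =
      Real.Gamma (a + k) / (Real.Gamma a * r ^ k) * gammaPDFReal (a + k) r x := by
  rcases hx.lt_or_gt with hx | hx
  · simp [gammaPDFReal, hx.not_ge]
  · have := Real.Gamma_pos_of_pos ha
    have : 0 < Real.Gamma (a + k) := Real.Gamma_pos_of_pos (by positivity)
    rw [gammaPDFReal, gammaPDFReal, if_pos hx.le, if_pos hx.le, add_sub_right_comm,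
      Real.rpow_add_natCast hx.ne', Real.rpow_add_natCast hr.ne']
    field_simp

theorem integrable_gammaPDFReal {a r : ℝ} (ha : 0 < a) (hr : 0 < r) :
    Integrable (gammaPDFReal a r) := by
  refine ⟨(stronglyMeasurable_gammaPDFReal a r).aestronglyMeasurable, ?_⟩
  rw [hasFiniteIntegral_iff_ofReal (ae_of_all _ (gammaPDFReal_nonneg ha hr))]
  exact (lintegral_gammaPDF_eq_one ha hr).trans_lt ENNReal.one_lt_top

theorem integral_gammaPDFReal {a r : ℝ} (ha : 0 < a) (hr : 0 < r) :
    ∫ x, gammaPDFReal a r x = 1 := by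
  rw [integral_eq_lintegral_of_nonneg_ae (ae_of_all _ (gammaPDFReal_nonneg ha hr))
    (stronglyMeasurable_gammaPDFReal a r).aestronglyMeasurable]
  exact (congrArg ENNReal.toReal (lintegral_gammaPDF_eq_one ha hr)).trans ENNReal.toReal_one

theorem measurable_gammaPDF (a r : ℝ) : Measurable (gammaPDF a r) :=
  (measurable_gammaPDFReal a r).ennreal_ofReal

theorem gammaPDF_toReal_smul_pow_ae_eq {a r : ℝ} (ha : 0 < a) (hr : 0 < r) (k : ℕ) :
    (fun x => (gammaPDF a r x).toReal • x ^ k) =ᵐ[volume]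
      fun x => Real.Gamma (a + k) / (Real.Gamma a * r ^ k) * gammaPDFReal (a + k) r x := by
  filter_upwards [Measure.ae_ne volume 0] with x hx
  rw [gammaPDF, ENNReal.toReal_ofReal (gammaPDFReal_nonneg ha hr x), smul_eq_mul,
    gammaPDFReal_mul_pow ha hr hx]

theorem integrable_pow_gammaMeasure {a r : ℝ} (ha : 0 < a) (hr : 0 < r) (k : ℕ) :
    Integrable (fun x => x ^ k) (gammaMeasure a r) := by
  rw [gammaMeasure, integrable_withDensity_iff_integrable_smul'
    (measurable_gammaPDF a r) (ae_of_all _ fun _ => ENNReal.ofReal_lt_top),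
    integrable_congr (gammaPDF_toReal_smul_pow_ae_eq ha hr k)]
  exact (integrable_gammaPDFReal (by positivity) hr).const_mul _

theorem integral_pow_gammaMeasure {a r : ℝ} (ha : 0 < a) (hr : 0 < r) (k : ℕ) :
    ∫ x, x ^ k ∂gammaMeasure a r = Real.Gamma (a + k) / (Real.Gamma a * r ^ k) := by
  rw [gammaMeasure, integral_withDensity_eq_integral_toReal_smul
    (measurable_gammaPDF a r) (ae_of_all _ fun _ => ENNReal.ofReal_lt_top),
    integral_congr_ae (gammaPDF_toReal_smul_pow_ae_eq ha hr k), integral_const_mul,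
    integral_gammaPDFReal (by positivity) hr, mul_one]

theorem integral_pow_expMeasure {r : ℝ} (hr : 0 < r) (k : ℕ) :
    ∫ x, x ^ k ∂expMeasure r = k.factorial / r ^ k := by
  rw [expMeasure, integral_pow_gammaMeasure one_pos hr, add_comm, Real.Gamma_nat_eq_factorial,
    Real.Gamma_one, one_mul]

variable {Ω : Type*} [MeasurableSpace Ω] {μ : Measure Ω} {Y : Ω → ℝ} {p : ℝ}

theorem memLp_two_of_hasLaw_exp (hp : 0 < p) (hY : HasLaw Y (expMeasure p⁻¹) μ) : MemLp Y 2 μ := by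
  have h := integrable_pow_gammaMeasure one_pos (inv_pos.2 hp) 2
  rw [← expMeasure, ← hY.map_eq] at h
  exact (memLp_two_iff_integrable_sq hY.aemeasurable.aestronglyMeasurable).2
    (h.comp_aemeasurable hY.aemeasurable)

theorem integral_of_hasLaw_exp (hp : 0 < p) (hY : HasLaw Y (expMeasure p⁻¹) μ) :
    ∫ ω, Y ω ∂μ = p := by
  rw [hY.integral_eq]
  simpa using integral_pow_expMeasure (inv_pos.2 hp) 1

theorem variance_of_hasLaw_exp (hp : 0 < p) (hY : HasLaw Y (expMeasure p⁻¹) μ) :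
    variance Y μ = p ^ 2 := by
  have := isProbabilityMeasure_expMeasure (inv_pos.2 hp)
  have hid : HasLaw id (expMeasure p⁻¹) (expMeasure p⁻¹) := .id
  rw [hY.variance_eq, variance_eq_sub (memLp_two_of_hasLaw_exp hp hid),
    integral_of_hasLaw_exp hp hid]
  simp only [Pi.pow_apply, id_eq]
  rw [integral_pow_expMeasure (inv_pos.2 hp) 2, inv_pow, div_inv_eq_mul, Nat.factorial_two]
  push_cast
  ring

theorem isPairwiseIndepArray_of_hasLaw_exp {Ω : Type*} [MeasurableSpace Ω] {μ : Measure Ω}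
    {N : ℕ → ℕ} {p : ℕ → ℕ → ℝ} {P : ℝ} {X : ℕ → ℕ → Ω → ℝ} (hp : ∀ M, ∀ n < N M, 0 < p M n)
    (hP : ∀ M, ∀ n < N M, p M n ≤ P)
    (hlaw : ∀ M, ∀ n < N M, HasLaw (X M n) (expMeasure (p M n)⁻¹) μ)
    (hindep : ∀ M, iIndepFun (fun n : Fin (N M) => X M n) μ) :
    IsPairwiseIndepArray μ N (P ^ 2) X where
  memLp M n hn := memLp_two_of_hasLaw_exp (hp M n hn) (hlaw M n hn)
  variance_le M n hn := by
    rw [variance_of_hasLaw_exp (hp M n hn) (hlaw M n hn)]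
    exact pow_le_pow_left₀ (hp M n hn).le (hP M n hn) 2
  indepFun M i hi j hj hij :=
    (hindep M).indepFun (i := ⟨i, hi⟩) (j := ⟨j, hj⟩) (by simpa using hij)

end Moments

/-! ### Almost sure consistency -/

section Consistency

theorem abs_intervalSum_sub_le_of_forall_abs_sum_range_le {x m : ℕ → ℝ} {N : ℕ} {ε : ℝ}
    (h : ∀ k ≤ N, |∑ n ∈ Finset.range k, (x n - m n)| ≤ ε) {a b : ℤ} (ha : a ≤ N) (hb : b ≤ N) :
    |intervalSum x a b - intervalSum m a b| ≤ 2 * ε := by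
  have h₁ := abs_le.1 (h a.toNat (by lia))
  have h₂ := abs_le.1 (h b.toNat (by lia))
  rw [Finset.sum_sub_distrib] at h₁ h₂
  rw [intervalSum, intervalSum, abs_le]
  constructor <;> linarith

theorem IsPairwiseIndepArray.ae_eventually_isNearSignal {Ω : Type*} [MeasurableSpace Ω]
    {μ : Measure Ω} [IsProbabilityMeasure μ] {A B : ℕ → ℤ} {γ V : ℝ} {X : ℕ → ℕ → Ω → ℝ}
    (hX : IsPairwiseIndepArray μ (2 ^ ·) V X)
    (hmean : ∀ M, ∀ n < 2 ^ M, ∫ ω, X M n ω ∂μ = meanPower γ (Finset.Ico (A M) (B M)) n)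
    (hA : ∀ᶠ M in atTop, 0 ≤ A M) (hAB : ∀ᶠ M in atTop, A M ≤ B M)
    (hB : ∀ᶠ M in atTop, B M ≤ 2 ^ M) :
    ∀ᵐ ω ∂μ, ∀ δ > 0, ∀ᶠ M in atTop,
      IsNearSignal (fun n => X M n ω) (2 ^ M) (A M) (B M) γ (δ * 2 ^ M) := by
  have hsum : Summable fun M : ℕ => (((2 ^ M : ℕ) : ℝ))⁻¹ := by
    simpa using summable_geometric_two
  filter_upwards [hX.ae_forall_eventually_forall_abs_sum_range_le
    (fun _ => Nat.two_pow_pos _) hsum] with ω hω δ hδ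
  filter_upwards [hω (δ / 2) (half_pos hδ), hA, hAB, hB] with M hM hAM hABM hBM
  refine ⟨hAM, hABM, hBM, fun a b _ hab hb => ?_⟩
  have hprefix : ∀ k ≤ 2 ^ M, |∑ n ∈ Finset.range k,
      (X M n ω - meanPower γ (Finset.Ico (A M) (B M)) n)| ≤ δ / 2 * 2 ^ M := by
    intro k hk
    have hsumEq : ∑ n ∈ Finset.range k, (X M n ω - ∫ ω', X M n ω' ∂μ) =
        ∑ n ∈ Finset.range k, (X M n ω - meanPower γ (Finset.Ico (A M) (B M)) n) :=
      Finset.sum_congr rfl fun n hn => by rw [hmean M n ((Finset.mem_range.1 hn).trans_le hk)]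
    exact_mod_cast hsumEq ▸ hM k hk
  calc _ ≤ 2 * (δ / 2 * 2 ^ M) := abs_intervalSum_sub_le_of_forall_abs_sum_range_le hprefix
        (mod_cast hab.trans hb) (mod_cast hb)
    _ = δ * 2 ^ M := by ring

theorem eventually_mul_two_pow_le_sub_floor {α β : ℝ} (hαβ : α < β) :
    ∀ᶠ M : ℕ in atTop,
      (β - α) / 2 * 2 ^ M ≤ (⌊β * (2 : ℝ) ^ M⌋ : ℝ) - ⌊α * (2 : ℝ) ^ M⌋ := by
  have hlim : Tendsto (fun M : ℕ => (2 : ℝ) ^ M) atTop atTop :=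
    tendsto_pow_atTop_atTop_of_one_lt one_lt_two
  filter_upwards [hlim.eventually_ge_atTop (2 / (β - α))] with M hM
  rw [div_le_iff₀ (sub_pos.2 hαβ)] at hM
  linarith [Int.floor_le (α * (2 : ℝ) ^ M), Int.sub_one_lt_floor (β * (2 : ℝ) ^ M)]

theorem floor_mul_two_pow_le {β : ℝ} (hβ : β ≤ 1) (M : ℕ) : ⌊β * (2 : ℝ) ^ M⌋ ≤ 2 ^ M := by
  exact_mod_cast (Int.floor_le (β * (2 : ℝ) ^ M)).trans (mul_le_of_le_one_left (by positivity) hβ)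

theorem theorem1_general {Ω : Type*} [MeasurableSpace Ω] (μ : Measure Ω) [IsProbabilityMeasure μ]
    (A B : ℕ → ℤ) (c γ V : ℝ) (hc : 0 < c) (hγ : 0 < γ) (hA : ∀ᶠ M in atTop, 0 ≤ A M)
    (hAB : ∀ᶠ M in atTop, c * 2 ^ M ≤ (B M : ℝ) - A M) (hB : ∀ᶠ M in atTop, B M ≤ 2 ^ M)
    (X : ℕ → ℕ → Ω → ℝ) (hX : IsPairwiseIndepArray μ (2 ^ ·) V X)
    (hmean : ∀ M, ∀ n < 2 ^ M, ∫ ω, X M n ω ∂μ = meanPower γ (Finset.Ico (A M) (B M)) n) :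
    ∀ᵐ ω ∂μ, Tendsto
      (fun p : ℕ × ℕ =>
        IoU (estimatedInterval (fun n => X p.1 n ω) p.1 p.2) (Finset.Ico (A p.1) (B p.1)))
      (atTop ×ˢ atTop) (𝓝 1) := by
  have hle : ∀ᶠ M in atTop, A M ≤ B M := hAB.mono fun M hM => by
    exact_mod_cast sub_nonneg.1 ((by positivity : 0 ≤ c * 2 ^ M).trans hM)
  filter_upwards [hX.ae_eventually_isNearSignal hmean hA hle hB] with ω hω
  exact tendsto_IoU_of_isNearSignal (x := fun M n => X M n ω) hc hγ hAB hω

end Consistency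

end Probability

open MeasureTheory ProbabilityTheory Filter Topology in
/-- `X M n` is the power of bin `n` in the problem of size `N = 2 ^ M`. Each problem is a family of
independent exponential variables; nothing is assumed on the joint law of different problems. -/
theorem theorem1 {Ω : Type*} [MeasurableSpace Ω] (μ : Measure Ω) [IsProbabilityMeasure μ]
    (α₀ β₀ γ : ℝ) (hα₀ : 0 < α₀) (hαβ : α₀ < β₀) (hβ₀ : β₀ < 1) (hγ : 0 < γ)
    (X : ℕ → ℕ → Ω → ℝ)
    (hlaw : ∀ M n : ℕ, n < 2 ^ M →
      HasLaw (X M n) (expMeasure (meanPower γ (trueInterval α₀ β₀ M) n)⁻¹) μ)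
    (hindep : ∀ M : ℕ, iIndepFun (fun n : Fin (2 ^ M) => X M n) μ) :
    ∀ᵐ ω ∂μ, Tendsto
      (fun p : ℕ × ℕ =>
        IoU (estimatedInterval (fun n => X p.1 n ω) p.1 p.2) (trueInterval α₀ β₀ p.1))
      (atTop ×ˢ atTop) (𝓝 1) := by
  have hpos M n : 0 < meanPower γ (trueInterval α₀ β₀ M) n := meanPower_pos hγ.le _ n
  have hX : IsPairwiseIndepArray μ (2 ^ ·) ((1 + γ) ^ 2) X := isPairwiseIndepArray_of_hasLaw_exp
    (fun M n _ => hpos M n) (fun M n _ => meanPower_le hγ.le _ n) hlaw hindep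
  exact theorem1_general μ _ _ _ γ _ (half_pos (sub_pos.2 hαβ)) hγ
    (.of_forall fun M => Int.floor_nonneg.2 (by positivity))
    (eventually_mul_two_pow_le_sub_floor hαβ) (.of_forall (floor_mul_two_pow_le hβ₀.le)) X hX
    fun M n hn => integral_of_hasLaw_exp (hpos M n) (hlaw M n hn)
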